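/- A weight on $\Omega\subseteq\mathbb R$ is a nonnegative locally integrable function $w$ on $\Omega$. For $1<r<\infty$, $w\in A_r$ means $$\sup_I\Big(\frac1{|I|}\int_I w\,dx\Big)\Big(\frac1{|I|}\int_I w^{-\frac1{r-1}}\,dx\Big)^{r-1}<\infty,$$ where the supremum is over all bounded nondegenerate intervals $I\subseteq\Omega$ (with $0^{-1/(r-1)}=\infty$ and $0\cdot\infty=\infty$). For an integer $n\ge 2$, the $n$-adic class $A_r^{n}$ is defined in the same way, with the supremum only over the $n$-adic intervals $\left[\frac{k-1}{n^m},\frac{k}{n^m}\right)\subseteq\Omega$, $m,k\in\mathbb Z$. Put $A_\infty=\bigcup_{r>1}A_r$ and $A_\infty^{n}=\bigcup_{r>1}A_r^{n}$. Let $\{p_1,\dots,p_M\}$ be any finite set of primes. Then, both for weights on $\Omega=\mathbb R$ and for weights on $\Omega=[0,1)$, $$\bigcap_{i=1}^M A_r^{p_i}\neq A_r\quad\text{for every } r>1,\qquad\text{and}\qquad \bigcap_{i=1}^M A_\infty^{p_i}\neq A_\infty .$$ -/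

import Mathlib

open MeasureTheory Set
open scoped ENNReal

/-- The bounded, nondegenerate intervals of the real line (in half-open form; the choice of the
end points does not affect averages). -/
def boundedIntervals : Set (Set ℝ) :=
  {I | ∃ a b : ℝ, a < b ∧ I = Ico a b}

/-- The standard `n`-adic system: all intervals `[(k - 1) / n ^ m, k / n ^ m)` with `m, k ∈ ℤ`. -/
def adicIntervals (n : ℕ) : Set (Set ℝ) :=
  {I | ∃ m k : ℤ, I = Ico (((k : ℝ) - 1) / (n : ℝ) ^ m) ((k : ℝ) / (n : ℝ) ^ m)}

/-- A weight on `Ω`: a nonnegative locally integrable function. -/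
structure IsWeightOn (Ω : Set ℝ) (w : ℝ → ℝ) : Prop where
  nonneg : ∀ x ∈ Ω, 0 ≤ w x
  locallyIntegrable : LocallyIntegrableOn w Ω volume

/-- The average of `w` over `I`, as an extended nonnegative real. -/
noncomputable def weightAvg (w : ℝ → ℝ) (I : Set ℝ) : ℝ≥0∞ :=
  ⨍⁻ x in I, ENNReal.ofReal (w x) ∂volume

/-- The average of `w ^ (-1 / (r - 1))` over `I`, as an extended nonnegative real
(at the zeros of `w` the integrand is `∞`). -/
noncomputable def dualAvg (r : ℝ) (w : ℝ → ℝ) (I : Set ℝ) : ℝ≥0∞ :=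
  ⨍⁻ x in I, ENNReal.ofReal (w x) ^ (-1 / (r - 1)) ∂volume

/-- The weights on `Ω` that satisfy the Muckenhoupt condition of exponent `r` along the intervals
of the family `𝓘` that lie in `Ω`. The requirement that the dual averages are finite only rules
out the product `0 * ∞` (which Lean evaluates to `0`) for a `w` that vanishes a.e. on some `I`. -/
def muckenhouptAlong (𝓘 : Set (Set ℝ)) (Ω : Set ℝ) (r : ℝ) : Set (ℝ → ℝ) :=
  {w | IsWeightOn Ω w ∧ (∀ I ∈ 𝓘, I ⊆ Ω → dualAvg r w I < ∞) ∧
    (⨆ I ∈ {I ∈ 𝓘 | I ⊆ Ω}, weightAvg w I * dualAvg r w I ^ (r - 1)) < ∞}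

/-- The Muckenhoupt class `A_r` on `Ω`. -/
def muckenhouptA (Ω : Set ℝ) (r : ℝ) : Set (ℝ → ℝ) :=
  muckenhouptAlong boundedIntervals Ω r

/-- The `n`-adic Muckenhoupt class `A_r^n` on `Ω`. -/
def adicMuckenhouptA (Ω : Set ℝ) (n : ℕ) (r : ℝ) : Set (ℝ → ℝ) :=
  muckenhouptAlong (adicIntervals n) Ω r

/-- The class `A_∞ = ⋃_{r > 1} A_r` on `Ω`. -/
def muckenhouptAInfty (Ω : Set ℝ) : Set (ℝ → ℝ) :=
  ⋃ r ∈ Ioi (1 : ℝ), muckenhouptA Ω r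

/-- The class `A_∞^n = ⋃_{r > 1} A_r^n` on `Ω`. -/
def adicMuckenhouptAInfty (Ω : Set ℝ) (n : ℕ) : Set (ℝ → ℝ) :=
  ⋃ r ∈ Ioi (1 : ℝ), adicMuckenhouptA Ω n r

/-! A single weight `w ≥ 1` serves every `r` and both domains. It equals `1` except for bumps near
points `y j → 0`. Each bump has a plateau of height `1 / √(ε j)` on the window `[y, y (1 + ε ^ 2)]`,
an inverse square root decay at scale `y` on the right, and the same decay at the much smaller scale
`ε y` on the left. Each side alone satisfies an `A₁` bound with constant 3 (`integral_cusp_le`), but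
the two sides differ: within distance `ε y` of `y` the weight is `1` on the left and `1 / √ε` on the
right. Intervals straddling `y` at that scale therefore violate every `A_r` as `ε j → 0`
(`notMem_muckenhouptA`).

The `p`-adic intervals never see this jump. By recurrence of a rotation on a torus, each window can
be made to contain a power of every `p` in the given set (`exists_zpow_near`), and a `p`-adic
interval that does not touch `0` has no power of `p` in its interior (`zpow_le_or_le_zpow`). Such an
interval lies on one side of a point of the window, where the `A₁` bound applies; it also meets at
most one bump. On `[0, L)` the masses of the lacunary bumps sum to `O(L)`, and on the negative axis
`w = 1`. So `w` is in `A₁` along `p`-adic intervals, hence in every `A_r^p`. -/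

/-! ### The truncated inverse square root profile. -/

/-- The function `1 / √d` with `d` clamped to `[ε, 1]`. -/
noncomputable def cusp (ε d : ℝ) : ℝ := 1 / √(max ε (min d 1))

lemma cusp_antitone {ε : ℝ} (hε : 0 < ε) : Antitone (cusp ε) := by
  intro a b hab
  unfold cusp
  have h : 0 < max ε (min a 1) := lt_max_of_lt_left hε
  have h' : 0 < √(max ε (min a 1)) := Real.sqrt_pos.2 h
  gcongr

lemma continuous_cusp {ε : ℝ} (hε : 0 < ε) : Continuous (cusp ε) := by
  unfold cusp
  refine continuous_const.div (by fun_prop) fun d ↦ ?_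
  have h : 0 < max ε (min d 1) := lt_max_of_lt_left hε
  exact (Real.sqrt_pos.2 h).ne'

lemma cusp_of_one_le {ε d : ℝ} (hε : ε ≤ 1) (hd : 1 ≤ d) : cusp ε d = 1 := by
  simp [cusp, min_eq_right hd, max_eq_right hε]

lemma cusp_of_le {ε d : ℝ} (hd : d ≤ ε) : cusp ε d = 1 / √ε := by
  rw [cusp, max_eq_left ((min_le_left d 1).trans hd)]

lemma one_le_cusp {ε : ℝ} (hε : 0 < ε) (hε1 : ε ≤ 1) (d : ℝ) : 1 ≤ cusp ε d := by
  have h := cusp_antitone hε (le_max_left d 1)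
  rwa [cusp_of_one_le hε1 (le_max_right d 1)] at h

lemma cusp_le {ε : ℝ} (hε : 0 < ε) (d : ℝ) : cusp ε d ≤ 1 / √ε := by
  have h := cusp_antitone hε (min_le_left d ε)
  rwa [cusp_of_le (min_le_right d ε)] at h

lemma cusp_le_one_add {ε d : ℝ} (hd : 0 < d) : cusp ε d ≤ d ^ (-(1 / 2) : ℝ) + 1 := by
  have hpos : 0 < d ^ (-(1 / 2) : ℝ) := Real.rpow_pos_of_pos hd _
  have hm : 0 < min d 1 := lt_min hd one_pos
  have h1 : cusp ε d ≤ 1 / √(min d 1) := by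
    unfold cusp
    have := Real.sqrt_pos.2 hm
    gcongr
    exact le_max_right _ _
  refine h1.trans ?_
  rcases le_total d 1 with h | h
  · rw [min_eq_left h, Real.rpow_neg hd.le, ← Real.sqrt_eq_rpow, one_div]
    linarith
  · rw [min_eq_right h, Real.sqrt_one, div_one]
    linarith

/-- The weight `cusp ε` satisfies the `A₁` condition along the intervals in `[0, ∞)`. -/
lemma integral_cusp_le {ε a b : ℝ} (hε : 0 < ε) (hε1 : ε ≤ 1) (ha : 0 ≤ a) (hab : a < b) :
    ∫ x in a..b, cusp ε x ≤ 3 * (b - a) * cusp ε b := by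
  have hint : ∀ a b : ℝ, IntervalIntegrable (cusp ε) volume a b :=
    fun a b ↦ (continuous_cusp hε).intervalIntegrable a b
  have hb : 0 < b := ha.trans_lt hab
  have hba : 0 < b - a := sub_pos.2 hab
  rcases le_total b ε with hbε | hbε
  · have h : ∫ x in a..b, cusp ε x ≤ ∫ _ in a..b, 1 / √ε :=
      intervalIntegral.integral_mono hab.le (hint a b) (by simp) fun x ↦ cusp_le hε x
    rw [intervalIntegral.integral_const, smul_eq_mul] at h
    rw [cusp_of_le hbε]
    have : 0 ≤ (b - a) * (1 / √ε) := by positivity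
    linarith
  · have hi : IntervalIntegrable (fun x : ℝ ↦ x ^ (-(1 / 2) : ℝ)) volume a b :=
      intervalIntegral.intervalIntegrable_rpow' (by norm_num)
    have h : ∫ x in a..b, cusp ε x ≤ ∫ x in a..b, (x ^ (-(1 / 2) : ℝ) + 1) := by
      refine intervalIntegral.integral_mono_on_of_le_Ioo hab.le (hint a b) (hi.add (by simp)) ?_
      exact fun x hx ↦ cusp_le_one_add (ha.trans_lt hx.1)
    rw [intervalIntegral.integral_add hi (by simp), integral_rpow (Or.inl (by norm_num)),
      intervalIntegral.integral_const, smul_eq_mul, mul_one] at h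
    have e : (-(1 / 2) + 1 : ℝ) = 1 / 2 := by norm_num
    rw [e, ← Real.sqrt_eq_rpow, ← Real.sqrt_eq_rpow] at h
    have hsb : 0 < √b := Real.sqrt_pos.2 hb
    -- From `√b - √a = (b - a) / (√a + √b)`. This gives 2 of the final constant 3; the summand `1`
    -- in `cusp_le_one_add` gives the rest.
    have h2 : (√b - √a) / (1 / 2) ≤ 2 * (b - a) * (1 / √b) := by
      have h3 : √a * √a = a := Real.mul_self_sqrt ha
      have h4 : √b * √b = b := Real.mul_self_sqrt hb.le
      have h5 : √a ≤ √b := Real.sqrt_le_sqrt hab.le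
      rw [mul_one_div, le_div_iff₀ hsb]
      nlinarith [Real.sqrt_nonneg a]
    rcases le_total b 1 with hb1 | hb1
    · have e2 : cusp ε b = 1 / √b := by rw [cusp, min_eq_left hb1, max_eq_right hbε]
      have h6 : 1 ≤ cusp ε b := one_le_cusp hε hε1 b
      rw [← e2] at h2
      nlinarith
    · rw [cusp_of_one_le hε1 hb1]
      have h6 : 1 / √b ≤ 1 := by
        rw [div_le_one hsb]; exact Real.one_le_sqrt.2 hb1
      nlinarith

/-! ### A single asymmetric bump. -/

/-- A weight with a cusp at scale `y` to the right of `y`, and at scale `ε * y` to the left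
of `y * (1 + ε ^ 2)`. -/
noncomputable def bump (ε y x : ℝ) : ℝ :=
  if x < y * (1 + ε ^ 2) then cusp ε ((y * (1 + ε ^ 2) - x) / (ε * y)) else cusp ε ((x - y) / y)

lemma one_le_bump {ε : ℝ} (hε : 0 < ε) (hε1 : ε ≤ 1) (y x : ℝ) : 1 ≤ bump ε y x := by
  unfold bump
  split_ifs <;> exact one_le_cusp hε hε1 _

lemma measurable_bump {ε : ℝ} (hε : 0 < ε) (y : ℝ) : Measurable (bump ε y) := by
  have h := (continuous_cusp hε).measurable
  exact Measurable.ite measurableSet_Iio (h.comp (by fun_prop)) (h.comp (by fun_prop))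

lemma bump_eq_left {ε y x : ℝ} (hε : 0 < ε) (hε1 : ε ≤ 1) (hy : 0 < y)
    (hx : x ≤ y * (1 + ε ^ 2)) : bump ε y x = cusp ε ((y * (1 + ε ^ 2) - x) / (ε * y)) := by
  rcases hx.lt_or_eq with h | h
  · rw [bump, if_pos h]
  · rw [bump, if_neg h.not_lt, cusp_of_le, cusp_of_le]
    · rw [h]; simp [hε.le]
    · rw [h, div_le_iff₀ hy]; nlinarith [mul_nonneg hy.le (mul_nonneg hε.le (sub_nonneg.2 hε1))]

/-- On the window `[y, y * (1 + ε ^ 2)]` both cusps are clamped to `1 / √ε`, so the right formula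
already holds from `y` on. Because of this overlap, an interval may be cut off at any point of the
window. -/
lemma bump_eq_right {ε y x : ℝ} (hε : 0 < ε) (hε1 : ε ≤ 1) (hy : 0 < y) (hx : y ≤ x) :
    bump ε y x = cusp ε ((x - y) / y) := by
  by_cases h : x < y * (1 + ε ^ 2)
  · have hεy : 0 < ε * y := by positivity
    rw [bump, if_pos h, cusp_of_le, cusp_of_le]
    · rw [div_le_iff₀ hy]; nlinarith
    · rw [div_le_iff₀ hεy]; nlinarith
  · rw [bump, if_neg h]

lemma bump_eq_one_of_le {ε y x : ℝ} (hε : 0 < ε) (hε4 : ε ≤ 1 / 4) (hy : 0 < y)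
    (hx : x ≤ y * (1 - ε)) : bump ε y x = 1 := by
  have hεy : 0 < ε * y := by positivity
  rw [bump_eq_left hε (by linarith) hy (by nlinarith), cusp_of_one_le (by linarith)]
  rw [one_le_div₀ hεy]; nlinarith [sq_nonneg ε]

lemma bump_eq_one_of_ge {ε y x : ℝ} (hε : 0 < ε) (hε1 : ε ≤ 1) (hy : 0 < y)
    (hx : 2 * y ≤ x) : bump ε y x = 1 := by
  rw [bump_eq_right hε hε1 hy (by linarith), cusp_of_one_le hε1]
  rw [one_le_div₀ hy]; linarith

lemma lintegral_Ico_ofReal_of_continuous {f : ℝ → ℝ} (hf : Continuous f) (h0 : ∀ x, 0 ≤ f x)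
    {a b : ℝ} (hab : a ≤ b) :
    ∫⁻ x in Ico a b, ENNReal.ofReal (f x) = ENNReal.ofReal (∫ x in a..b, f x) := by
  rw [intervalIntegral.integral_of_le hab, ← integral_Ico_eq_integral_Ioc,
    ofReal_integral_eq_lintegral_ofReal]
  · exact (hf.integrableOn_Icc).mono_set Ico_subset_Icc_self
  · exact Filter.Eventually.of_forall h0

lemma lintegral_bump_le_right {ε y a b : ℝ} (hε : 0 < ε) (hε1 : ε ≤ 1) (hy : 0 < y)
    (ha : y ≤ a) (hab : a < b) :
    ∫⁻ x in Ico a b, ENNReal.ofReal (bump ε y x) ≤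
      ENNReal.ofReal (3 * (b - a) * bump ε y b) := by
  have h1 : ∫⁻ x in Ico a b, ENNReal.ofReal (bump ε y x) =
      ∫⁻ x in Ico a b, ENNReal.ofReal (cusp ε ((x - y) / y)) :=
    setLIntegral_congr_fun measurableSet_Ico fun x hx ↦ by
      simp only [bump_eq_right hε hε1 hy (ha.trans hx.1)]
  rw [h1, lintegral_Ico_ofReal_of_continuous (f := fun x ↦ cusp ε ((x - y) / y))
    ((continuous_cusp hε).comp (by fun_prop)) (fun x ↦ zero_le_one.trans (one_le_cusp hε hε1 _)) hab.le]
  refine ENNReal.ofReal_le_ofReal ?_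
  have h2 : ∫ x in a..b, cusp ε ((x - y) / y) = y * ∫ x in (a - y) / y..(b - y) / y, cusp ε x := by
    simp_rw [sub_div]
    rw [intervalIntegral.integral_comp_div_sub _ hy.ne', smul_eq_mul]
  have h3 : (a - y) / y < (b - y) / y := by gcongr
  have h4 := integral_cusp_le hε hε1 (div_nonneg (sub_nonneg.2 ha) hy.le) h3
  rw [h2, bump_eq_right hε hε1 hy (ha.trans hab.le)]
  refine (mul_le_mul_of_nonneg_left h4 hy.le).trans_eq ?_
  field_simp
  ring

lemma lintegral_bump_le_left {ε y a b : ℝ} (hε : 0 < ε) (hε1 : ε ≤ 1) (hy : 0 < y)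
    (hb : b ≤ y * (1 + ε ^ 2)) (hab : a < b) :
    ∫⁻ x in Ico a b, ENNReal.ofReal (bump ε y x) ≤
      ENNReal.ofReal (3 * (b - a) * bump ε y a) := by
  have hεy : 0 < ε * y := by positivity
  set t := y * (1 + ε ^ 2) with ht
  have h1 : ∫⁻ x in Ico a b, ENNReal.ofReal (bump ε y x) =
      ∫⁻ x in Ico a b, ENNReal.ofReal (cusp ε ((t - x) / (ε * y))) :=
    setLIntegral_congr_fun measurableSet_Ico fun x hx ↦ by
      simp only [bump_eq_left hε hε1 hy (hx.2.le.trans hb), ht]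
  rw [h1, lintegral_Ico_ofReal_of_continuous (f := fun x ↦ cusp ε ((t - x) / (ε * y)))
    ((continuous_cusp hε).comp (by fun_prop)) (fun x ↦ zero_le_one.trans (one_le_cusp hε hε1 _)) hab.le]
  refine ENNReal.ofReal_le_ofReal ?_
  have h2 : ∫ x in a..b, cusp ε ((t - x) / (ε * y)) =
      ε * y * ∫ x in (t - b) / (ε * y)..(t - a) / (ε * y), cusp ε x := by
    simp_rw [sub_div]
    rw [intervalIntegral.integral_comp_sub_div _ hεy.ne', smul_eq_mul]
  have h3 : (t - b) / (ε * y) < (t - a) / (ε * y) := by gcongr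
  have h4 := integral_cusp_le hε hε1 (div_nonneg (sub_nonneg.2 hb) hεy.le) h3
  rw [h2, bump_eq_left hε hε1 hy (hab.le.trans hb)]
  refine (mul_le_mul_of_nonneg_left h4 hεy.le).trans_eq ?_
  rw [← ht]
  field_simp
  ring

lemma bump_le_left {ε y a x : ℝ} (hε : 0 < ε) (hε1 : ε ≤ 1) (hy : 0 < y)
    (hx : x ≤ y * (1 + ε ^ 2)) (hax : a ≤ x) : bump ε y a ≤ bump ε y x := by
  rw [bump_eq_left hε hε1 hy hx, bump_eq_left hε hε1 hy (hax.trans hx)]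
  have hεy : 0 < ε * y := by positivity
  exact cusp_antitone hε (by gcongr)

lemma bump_le_right {ε y b x : ℝ} (hε : 0 < ε) (hε1 : ε ≤ 1) (hy : 0 < y)
    (hx : y ≤ x) (hxb : x ≤ b) : bump ε y b ≤ bump ε y x := by
  rw [bump_eq_right hε hε1 hy hx, bump_eq_right hε hε1 hy (hx.trans hxb)]
  exact cusp_antitone hε (by gcongr)

/-- The excess over `1` lives on `[y / 2, 2 * y)` and its mass is comparable to `y` by the two
one-sided bounds, whose end values are `1`. If `2 * L ≤ y`, the support misses `[0, L)`. -/
lemma lintegral_bump_sub_one_le {ε y : ℝ} (hε : 0 < ε) (hε4 : ε ≤ 1 / 4) (hy : 0 < y) (L : ℝ) :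
    ∫⁻ x in Ico 0 L, ENNReal.ofReal (bump ε y x - 1) ≤
      ENNReal.ofReal (5 * if y < 2 * L then y else 0) := by
  have hε1 : ε ≤ 1 := by linarith
  split_ifs with hL
  · set t := y * (1 + ε ^ 2) with ht
    have ht1 : y / 2 < t := by nlinarith [sq_nonneg ε]
    have ht2 : t < 2 * y := by nlinarith [mul_nonneg hy.le (mul_nonneg hε.le (sub_nonneg.2 hε1))]
    calc ∫⁻ x in Ico 0 L, ENNReal.ofReal (bump ε y x - 1)
        ≤ ∫⁻ x, ENNReal.ofReal (bump ε y x - 1) := setLIntegral_le_lintegral _ _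
      _ ≤ ∫⁻ x, (Ico (y / 2) (2 * y)).indicator (fun x ↦ ENNReal.ofReal (bump ε y x)) x := by
          refine lintegral_mono fun x ↦ ?_
          by_cases hx : x ∈ Ico (y / 2) (2 * y)
          · rw [indicator_of_mem hx]
            exact ENNReal.ofReal_le_ofReal (by linarith)
          · rw [indicator_of_notMem hx]
            have : bump ε y x = 1 := by
              rcases lt_or_ge x (y / 2) with h | h
              · exact bump_eq_one_of_le hε hε4 hy (by nlinarith)
              · exact bump_eq_one_of_ge hε hε1 hy (not_lt.1 fun h' ↦ hx ⟨h, h'⟩)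
            simp [this]
      _ = ∫⁻ x in Ico (y / 2) t ∪ Ico t (2 * y), ENNReal.ofReal (bump ε y x) := by
          rw [lintegral_indicator measurableSet_Ico, Ico_union_Ico_eq_Ico ht1.le ht2.le]
      _ ≤ ENNReal.ofReal (3 * (t - y / 2) * bump ε y (y / 2)) +
            ENNReal.ofReal (3 * (2 * y - t) * bump ε y (2 * y)) :=
          (lintegral_union_le _ _ _).trans (add_le_add
            (lintegral_bump_le_left hε hε1 hy le_rfl ht1)
            (lintegral_bump_le_right hε hε1 hy (by nlinarith [sq_nonneg ε]) ht2))
      _ ≤ ENNReal.ofReal (5 * y) := by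
          rw [bump_eq_one_of_le hε hε4 hy (by nlinarith), bump_eq_one_of_ge hε hε1 hy le_rfl,
            ← ENNReal.ofReal_add (by linarith) (by linarith)]
          exact ENNReal.ofReal_le_ofReal (by linarith)
  · have : ∫⁻ x in Ico 0 L, ENNReal.ofReal (bump ε y x - 1) = ∫⁻ x in Ico 0 L, 0 :=
      setLIntegral_congr_fun measurableSet_Ico fun x hx ↦ by
        have h2 := hx.2
        simp only [bump_eq_one_of_le hε hε4 hy (by nlinarith : x ≤ y * (1 - ε))]
        simp
    simp [this]

/-! ### Lacunary superposition of bumps. -/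

/-- Parameters of a family of bumps that live on disjoint intervals accumulating at `0`. -/
structure IsLacunary (ε y : ℕ → ℝ) : Prop where
  eps_pos : ∀ j, 0 < ε j
  eps_le : ∀ j, ε j ≤ 1 / 4
  pos : ∀ j, 0 < y j
  succ_le : ∀ j, y (j + 1) ≤ y j / 8

/-- The superposition of a sequence of bumps. -/
noncomputable def cuspWeight (ε y : ℕ → ℝ) (x : ℝ) : ℝ := 1 + ∑' j, (bump (ε j) (y j) x - 1)

namespace IsLacunary

variable {ε y : ℕ → ℝ}

lemma eps_le_one (h : IsLacunary ε y) (j : ℕ) : ε j ≤ 1 := (h.eps_le j).trans (by norm_num)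

lemma le_of_lt (h : IsLacunary ε y) {i j : ℕ} (hij : i < j) : y j ≤ y i / 8 := by
  induction j, hij using Nat.le_induction with
  | base => exact h.succ_le i
  | succ k hk ih =>
    have h1 := h.succ_le k
    have h2 := h.pos k
    linarith

lemma bump_eq_one (h : IsLacunary ε y) {j : ℕ} {x : ℝ} (hx : x < y j / 2 ∨ 2 * y j ≤ x) :
    bump (ε j) (y j) x = 1 := by
  have h1 := h.eps_le j
  have h2 := h.pos j
  rcases hx with hx | hx
  · exact bump_eq_one_of_le (h.eps_pos j) h1 h2 (by nlinarith)
  · exact bump_eq_one_of_ge (h.eps_pos j) (h.eps_le_one j) h2 hx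

lemma bump_eq_one_of_ne (h : IsLacunary ε y) {i j : ℕ} {x : ℝ} (hij : i ≠ j)
    (hx : y j / 4 < x) (hx' : x < 4 * y j) : bump (ε i) (y i) x = 1 := by
  rcases hij.lt_or_gt with hlt | hlt
  · exact h.bump_eq_one (Or.inl (by linarith [h.le_of_lt hlt]))
  · exact h.bump_eq_one (Or.inr (by linarith [h.le_of_lt hlt]))

/-- If the interval meets the support `[y j / 2, 2 * y j)`, then `b ≤ 2 * a` confines it to `(y j /
4, 4 * y j)`, which the ratio 8 keeps clear of all other supports. -/
lemma exists_forall_ne (h : IsLacunary ε y) {a b : ℝ} (hab : b ≤ 2 * a) :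
    ∃ j, ∀ i ≠ j, ∀ x ∈ Ico a b, bump (ε i) (y i) x = 1 := by
  by_cases H : ∃ j, ∃ x ∈ Ico a b, bump (ε j) (y j) x ≠ 1
  · obtain ⟨j, x, hx, hj⟩ := H
    have h1 : y j / 2 ≤ x := not_lt.1 fun h' ↦ hj (h.bump_eq_one (Or.inl h'))
    have h2 : x < 2 * y j := not_le.1 fun h' ↦ hj (h.bump_eq_one (Or.inr h'))
    refine ⟨j, fun i hij z hz ↦ h.bump_eq_one_of_ne hij ?_ ?_⟩ <;>
      linarith [hx.1, hx.2, hz.1, hz.2]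
  · push Not at H
    exact ⟨0, fun i _ ↦ H i⟩

lemma exists_forall_ne_point (h : IsLacunary ε y) (x : ℝ) :
    ∃ j, ∀ i ≠ j, bump (ε i) (y i) x = 1 := by
  rcases le_or_gt x 0 with hx | hx
  · exact ⟨0, fun i _ ↦ h.bump_eq_one (Or.inl (by linarith [h.pos i]))⟩
  · obtain ⟨j, hj⟩ := h.exists_forall_ne (le_refl (2 * x))
    exact ⟨j, fun i hij ↦ hj i hij x ⟨le_rfl, by linarith⟩⟩

lemma cuspWeight_eq_bump {j : ℕ} {x : ℝ} (hj : ∀ i ≠ j, bump (ε i) (y i) x = 1) :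
    cuspWeight ε y x = bump (ε j) (y j) x := by
  rw [cuspWeight, tsum_eq_single j fun i hi ↦ by rw [hj i hi, sub_self]]
  ring

lemma one_le_cuspWeight (h : IsLacunary ε y) (x : ℝ) : 1 ≤ cuspWeight ε y x := by
  obtain ⟨j, hj⟩ := h.exists_forall_ne_point x
  rw [cuspWeight_eq_bump hj]
  exact one_le_bump (h.eps_pos j) (h.eps_le_one j) _ _

lemma cuspWeight_of_nonpos (h : IsLacunary ε y) {x : ℝ} (hx : x ≤ 0) :
    cuspWeight ε y x = 1 := by
  have h1 : ∀ j, bump (ε j) (y j) x = 1 := fun j ↦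
    h.bump_eq_one (Or.inl (by linarith [h.pos j]))
  simp [cuspWeight, h1]

/-- In `ℝ≥0∞` the sum can be measured and integrated termwise without summability conditions. -/
lemma ofReal_cuspWeight (h : IsLacunary ε y) (x : ℝ) :
    ENNReal.ofReal (cuspWeight ε y x) =
      1 + ∑' j, ENNReal.ofReal (bump (ε j) (y j) x - 1) := by
  obtain ⟨j, hj⟩ := h.exists_forall_ne_point x
  have h1 := one_le_bump (h.eps_pos j) (h.eps_le_one j) (y j) x
  rw [cuspWeight_eq_bump hj, tsum_eq_single j fun i hi ↦ by simp [hj i hi],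
    ← ENNReal.ofReal_one, ← ENNReal.ofReal_add zero_le_one (sub_nonneg.2 h1)]
  ring_nf

lemma measurable_cuspWeight (h : IsLacunary ε y) : Measurable (cuspWeight ε y) := by
  have h1 : Measurable fun x ↦ ENNReal.ofReal (cuspWeight ε y x) := by
    simp_rw [h.ofReal_cuspWeight]
    exact measurable_const.add (Measurable.tsum fun j ↦
      ((measurable_bump (h.eps_pos j) _).sub_const 1).ennreal_ofReal)
  have h2 : cuspWeight ε y = fun x ↦ (ENNReal.ofReal (cuspWeight ε y x)).toReal := by
    ext x
    rw [ENNReal.toReal_ofReal (zero_le_one.trans (h.one_le_cuspWeight x))]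
  rw [h2]
  exact h1.ennreal_toReal

/-- The induction removes the first term, hence the shift `k`. The minimum keeps track of both
bounds: once `y k < c`, the tail costs at most `2 * y (k + 1) ≤ y k / 4`. -/
lemma sum_ite_lt_le (h : IsLacunary ε y) {c : ℝ} (hc : 0 ≤ c) (N : ℕ) (k : ℕ) :
    ∑ j ∈ Finset.range N, (if y (j + k) < c then y (j + k) else 0) ≤ 2 * min c (y k) := by
  induction N generalizing k with
  | zero =>
    have : 0 ≤ min c (y k) := le_min hc (h.pos k).le
    simpa using this
  | succ N ih =>
    rw [Finset.sum_range_succ']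
    have h1 := ih (k + 1)
    have h2 := h.succ_le k
    have h3 := h.pos k
    have h4 : ∀ j, j + 1 + k = j + (k + 1) := fun j ↦ by ring
    simp only [h4, zero_add]
    have h5 := min_le_right c (y (k + 1))
    split_ifs with hk
    · rw [min_eq_right hk.le]
      linarith
    · have h6 : y (k + 1) ≤ y k := by linarith
      rw [add_zero]
      exact h1.trans (by gcongr)

lemma tsum_ite_lt_le (h : IsLacunary ε y) {c : ℝ} (hc : 0 ≤ c) :
    ∑' j, ENNReal.ofReal (5 * if y j < c then y j else 0) ≤ ENNReal.ofReal (10 * c) := by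
  rw [ENNReal.tsum_eq_iSup_nat]
  refine iSup_le fun N ↦ ?_
  rw [← ENNReal.ofReal_sum_of_nonneg]
  · refine ENNReal.ofReal_le_ofReal ?_
    rw [← Finset.mul_sum]
    have h1 := h.sum_ite_lt_le hc N 0
    have h2 := min_le_left c (y 0)
    simp only [add_zero] at h1
    linarith
  · intro j _
    have := h.pos j
    positivity

lemma lintegral_cuspWeight_Ico_zero_le (h : IsLacunary ε y) {L : ℝ} (hL : 0 ≤ L) :
    ∫⁻ x in Ico 0 L, ENNReal.ofReal (cuspWeight ε y x) ≤ ENNReal.ofReal (21 * L) := by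
  simp_rw [h.ofReal_cuspWeight]
  rw [lintegral_add_left measurable_const, lintegral_tsum fun j ↦
    ((measurable_bump (h.eps_pos j) _).sub_const 1).ennreal_ofReal.aemeasurable,
    setLIntegral_const, Real.volume_Ico, one_mul, sub_zero]
  have h1 : ∑' j, ∫⁻ x in Ico 0 L, ENNReal.ofReal (bump (ε j) (y j) x - 1) ≤
      ENNReal.ofReal (10 * (2 * L)) :=
    (ENNReal.tsum_le_tsum fun j ↦
      lintegral_bump_sub_one_le (h.eps_pos j) (h.eps_le j) (h.pos j) L).trans
      (h.tsum_ite_lt_le (by positivity))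
  refine (add_le_add_right h1 _).trans_eq ?_
  rw [← ENNReal.ofReal_add hL (by positivity)]
  ring_nf

lemma lintegral_cuspWeight_of_nonpos (h : IsLacunary ε y) {a b : ℝ} (hb : b ≤ 0) :
    ∫⁻ x in Ico a b, ENNReal.ofReal (cuspWeight ε y x) = ENNReal.ofReal (b - a) := by
  rw [setLIntegral_congr_fun (g := fun _ ↦ 1) measurableSet_Ico fun x hx ↦ by
    simp [h.cuspWeight_of_nonpos (hx.2.le.trans hb)]]
  simp

lemma locallyIntegrable_cuspWeight (h : IsLacunary ε y) :
    LocallyIntegrable (cuspWeight ε y) volume := by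
  intro x
  refine ⟨Ioo (-(|x| + 1)) (|x| + 1), Ioo_mem_nhds ?_ ?_,
    h.measurable_cuspWeight.aestronglyMeasurable, ?_⟩
  · linarith [neg_abs_le x]
  · linarith [le_abs_self x]
  · rw [hasFiniteIntegral_iff_ofReal
      (.of_forall fun x ↦ zero_le_one.trans (h.one_le_cuspWeight x))]
    have hR : 0 ≤ |x| + 1 := by positivity
    have hsub : Ioo (-(|x| + 1)) (|x| + 1) ⊆ Ico (-(|x| + 1)) 0 ∪ Ico 0 (|x| + 1) := by
      rw [Ico_union_Ico_eq_Ico (by linarith) hR]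
      exact Ioo_subset_Ico_self
    refine (lintegral_mono_set hsub).trans_lt ((lintegral_union_le _ _ _).trans_lt ?_)
    rw [h.lintegral_cuspWeight_of_nonpos le_rfl]
    exact ENNReal.add_lt_top.2 ⟨ENNReal.ofReal_lt_top,
      (h.lintegral_cuspWeight_Ico_zero_le hR).trans_lt ENNReal.ofReal_lt_top⟩

/-- Only one bump matters, and the interval lies on one side of a point `z` of its window. There the
bump is monotone with its minimum at the far end, so the one-sided `A₁` bound compares with every
value on the interval. -/
lemma lintegral_cuspWeight_le (h : IsLacunary ε y) {a b : ℝ} (hab : a < b) (hb : b ≤ 2 * a)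
    (hcross : ∀ j, ∃ z, y j ≤ z ∧ z ≤ y j * (1 + ε j ^ 2) ∧ (b ≤ z ∨ z ≤ a))
    {x : ℝ} (hx : x ∈ Ico a b) :
    ∫⁻ t in Ico a b, ENNReal.ofReal (cuspWeight ε y t) ≤
      ENNReal.ofReal (3 * (b - a) * cuspWeight ε y x) := by
  obtain ⟨j, hj⟩ := h.exists_forall_ne hb
  have heq : ∀ t ∈ Ico a b, cuspWeight ε y t = bump (ε j) (y j) t :=
    fun t ht ↦ cuspWeight_eq_bump fun i hi ↦ hj i hi t ht
  rw [setLIntegral_congr_fun measurableSet_Ico fun t ht ↦ by rw [heq t ht], heq x hx]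
  have hba : 0 ≤ 3 * (b - a) := by linarith
  obtain ⟨z, hz1, hz2, hz | hz⟩ := hcross j
  · refine (lintegral_bump_le_left (h.eps_pos j) (h.eps_le_one j) (h.pos j)
      (hz.trans hz2) hab).trans (ENNReal.ofReal_le_ofReal (mul_le_mul_of_nonneg_left ?_ hba))
    exact bump_le_left (h.eps_pos j) (h.eps_le_one j) (h.pos j) (hx.2.le.trans (hz.trans hz2)) hx.1
  · refine (lintegral_bump_le_right (h.eps_pos j) (h.eps_le_one j) (h.pos j)
      (hz1.trans hz) hab).trans (ENNReal.ofReal_le_ofReal (mul_le_mul_of_nonneg_left ?_ hba))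
    exact bump_le_right (h.eps_pos j) (h.eps_le_one j) (h.pos j) (hz1.trans (hz.trans hx.1)) hx.2.le

end IsLacunary

/-! ### Points with nearby powers of all bases. -/

/-- Simultaneous approximation: finitely many bases have powers that nearly agree. -/
lemma exists_zpow_near (S : Finset ℕ) (hS : ∀ p ∈ S, 2 ≤ p) {δ ε : ℝ} (hδ : 0 < δ)
    (hε : 0 < ε) : ∃ y : ℝ, 0 < y ∧ y ≤ δ ∧
      ∀ p ∈ S, ∃ m : ℤ, y ≤ (p : ℝ) ^ m ∧ (p : ℝ) ^ m ≤ y * (1 + ε) := by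
  set s := Real.log (1 + ε) / 2 with hs
  have hs0 : 0 < s := half_pos (Real.log_pos (by linarith))
  have hlog : ∀ p ∈ S, 0 < Real.log p := fun p hp ↦ Real.log_pos (by exact_mod_cast hS p hp)
  set B := 1 + ∑ p ∈ S, Real.log p with hB
  have hB0 : 0 < B := add_pos_of_pos_of_nonneg one_pos (Finset.sum_nonneg fun p hp ↦ (hlog p hp).le)
  have hlogB : ∀ p ∈ S, Real.log p ≤ B := fun p hp ↦
    (Finset.single_le_sum (fun q hq ↦ (hlog q hq).le) hp).trans (by linarith)
  -- Recurrence of the rotation by `α` gives arbitrarily large `n` with every `n / log p` close to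
  -- an integer, so that `exp (-n)` is close to a power of each `p`.
  let α : S → UnitAddCircle := fun p ↦ ((1 / Real.log (p : ℕ) : ℝ) : UnitAddCircle)
  have hfreq := (mapClusterPt_zero_atTop_nsmul α).frequently
    (Metric.ball_mem_nhds 0 (div_pos hs0 hB0))
  obtain ⟨N, hN⟩ := exists_nat_gt (-Real.log δ)
  obtain ⟨n, hn, hNn⟩ := (hfreq.and_eventually (Filter.eventually_ge_atTop N)).exists
  have hNn' : (N : ℝ) ≤ n := by exact_mod_cast hNn
  -- The window has multiplicative width `1 + ε = exp (2 * s)` and is centred logarithmically at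
  -- `exp (-n)`.
  refine ⟨Real.exp (-n - s), Real.exp_pos _, ?_, fun p hp ↦ ⟨-round ((n : ℝ) / Real.log p), ?_⟩⟩
  · rw [← Real.le_log_iff_exp_le hδ]
    linarith
  · have hp0 : (0 : ℝ) < p := by exact_mod_cast (by norm_num : 0 < 2).trans_le (hS p hp)
    have h1 : ‖(n • α) ⟨p, hp⟩‖ < s / B :=
      (norm_le_pi_norm _ _).trans_lt (by simpa using hn)
    have h2 : (n • α) ⟨p, hp⟩ = (((n : ℝ) / Real.log p : ℝ) : UnitAddCircle) := by
      simp only [α, Pi.smul_apply]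
      rw [← AddCircle.coe_nsmul, nsmul_eq_mul, mul_one_div]
    rw [h2, UnitAddCircle.norm_eq] at h1
    set m := round ((n : ℝ) / Real.log p)
    have hl := hlog p hp
    have h3 : |(n : ℝ) - m * Real.log p| ≤ s := by
      have h4 : (n : ℝ) - m * Real.log p = ((n : ℝ) / Real.log p - m) * Real.log p := by
        field_simp
      rw [h4, abs_mul, abs_of_pos hl]
      calc _ ≤ s / B * B := mul_le_mul h1.le (hlogB p hp) hl.le (by positivity)
        _ = s := by field_simp
    have h5 : (p : ℝ) ^ (-m) = Real.exp (-(m * Real.log p)) := by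
      rw [← Real.rpow_intCast, Real.rpow_def_of_pos hp0]
      push_cast
      ring_nf
    have h6 : 1 + ε = Real.exp (2 * s) := by
      rw [hs, mul_div_cancel₀ _ two_ne_zero, Real.exp_log (by linarith)]
    rw [h5, h6, ← Real.exp_add, Real.exp_le_exp, Real.exp_le_exp]
    constructor <;> linarith [abs_le.1 h3]

lemma exists_isLacunary (S : Finset ℕ) (hS : ∀ p ∈ S, 2 ≤ p) :
    ∃ y : ℕ → ℝ, IsLacunary (fun j ↦ 1 / ((j : ℝ) + 4)) y ∧ (∀ j, y j ≤ 1 / 2) ∧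
      ∀ p ∈ S, ∀ j, ∃ m : ℤ, y j ≤ (p : ℝ) ^ m ∧
        (p : ℝ) ^ m ≤ y j * (1 + (1 / ((j : ℝ) + 4)) ^ 2) := by
  -- Positivity of `δ` is a premise inside the existential, so that `choose` yields a function on
  -- all reals and the recursion can be defined before its values are known to be positive.
  have key : ∀ (j : ℕ) (δ : ℝ), ∃ y : ℝ, 0 < δ → 0 < y ∧ y ≤ δ ∧
      ∀ p ∈ S, ∃ m : ℤ, y ≤ (p : ℝ) ^ m ∧ (p : ℝ) ^ m ≤ y * (1 + (1 / ((j : ℝ) + 4)) ^ 2) := by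
    intro j δ
    by_cases hδ : 0 < δ
    · obtain ⟨y, hy⟩ := exists_zpow_near S hS hδ (by positivity : 0 < (1 / ((j : ℝ) + 4)) ^ 2)
      exact ⟨y, fun _ ↦ hy⟩
    · exact ⟨0, fun h ↦ absurd h hδ⟩
  choose f hf using key
  let y : ℕ → ℝ := fun j ↦ Nat.rec (f 0 (1 / 2)) (fun k z ↦ f (k + 1) (z / 8)) j
  have hpos : ∀ j, 0 < y j := by
    intro j
    induction j with
    | zero => exact (hf 0 (1 / 2) (by norm_num)).1
    | succ k ih => exact (hf (k + 1) (y k / 8) (by positivity)).1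
  have hsucc : ∀ j, y (j + 1) ≤ y j / 8 := fun j ↦
    (hf (j + 1) (y j / 8) (div_pos (hpos j) (by norm_num))).2.1
  have hle : ∀ j, y j ≤ 1 / 2 := by
    intro j
    induction j with
    | zero => exact (hf 0 (1 / 2) (by norm_num)).2.1
    | succ k ih => linarith [hsucc k, hpos k]
  refine ⟨y, ⟨fun j ↦ by positivity, fun j ↦ ?_, hpos, hsucc⟩, hle, fun p hp j ↦ ?_⟩
  · exact one_div_le_one_div_of_le (by norm_num) (by linarith [(Nat.cast_nonneg j : (0 : ℝ) ≤ j)])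
  · cases j with
    | zero => exact (hf 0 (1 / 2) (by norm_num)).2.2 p hp
    | succ k => exact (hf (k + 1) (y k / 8) (div_pos (hpos k) (by norm_num))).2.2 p hp

/-! ### Adic intervals and powers of the base. -/

/-- An `n`-adic interval that does not touch `0` contains no power of `n` in its interior. -/
lemma zpow_le_or_le_zpow {n : ℕ} (hn : 2 ≤ n) (m M k : ℤ) (hk : 2 ≤ k) :
    (k : ℝ) / (n : ℝ) ^ m ≤ (n : ℝ) ^ M ∨ (n : ℝ) ^ M ≤ ((k : ℝ) - 1) / (n : ℝ) ^ m := by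
  have hn0 : (0 : ℝ) < n := by exact_mod_cast (by norm_num : 0 < 2).trans_le hn
  have hn1 : (1 : ℝ) ≤ n := by exact_mod_cast (by norm_num : 1 ≤ 2).trans hn
  have hm : (0 : ℝ) < (n : ℝ) ^ m := zpow_pos hn0 m
  rw [div_le_iff₀ hm, le_div_iff₀ hm, ← zpow_add₀ hn0.ne']
  -- For `0 ≤ M + m` the power is an integer, so it cannot lie strictly between `k - 1` and `k`;
  -- otherwise it is at most `1 ≤ k - 1`.
  rcases le_or_gt 0 (M + m) with h | h
  · obtain ⟨N, hN⟩ := Int.eq_ofNat_of_zero_le h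
    rw [hN]
    have h1 : (n : ℝ) ^ (N : ℤ) = (((n : ℤ) ^ N : ℤ) : ℝ) := by push_cast; simp
    rw [h1]
    rcases le_or_gt k ((n : ℤ) ^ N) with h2 | h2
    · exact Or.inl (by exact_mod_cast h2)
    · exact Or.inr (by exact_mod_cast Int.le_sub_one_of_lt h2)
  · right
    have h1 : (n : ℝ) ^ (M + m) ≤ 1 := zpow_le_one_of_nonpos₀ hn1 h.le
    have h2 : (2 : ℝ) ≤ k := by exact_mod_cast hk
    linarith

/-! ### From `A₁` bounds to `A_r`, and lower bounds for averages. -/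

lemma weightAvg_Ico_le {w : ℝ → ℝ} {a b c : ℝ} (hc : 0 ≤ c)
    (h : ∫⁻ x in Ico a b, ENNReal.ofReal (w x) ≤ ENNReal.ofReal (c * (b - a))) :
    weightAvg w (Ico a b) ≤ ENNReal.ofReal c := by
  rw [weightAvg, setLAverage_eq, Real.volume_Ico]
  exact ENNReal.div_le_of_le_mul (h.trans_eq (ENNReal.ofReal_mul hc))

/-- The `A₁` condition implies the `A_r` condition, for a weight that is bounded below by `1`. -/
lemma mem_muckenhouptAlong_of_weightAvg_le {𝓘 : Set (Set ℝ)} {Ω : Set ℝ} {r : ℝ} {w : ℝ → ℝ}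
    {C : ℝ≥0∞} (hr : 1 < r) (hw : IsWeightOn Ω w) (h1 : ∀ x, 1 ≤ w x) (hC0 : C ≠ 0) (hC : C ≠ ∞)
    (hI : ∀ I ∈ 𝓘, MeasurableSet I ∧ volume I ≠ 0 ∧ volume I ≠ ∞ ∧
      ∀ x ∈ I, weightAvg w I ≤ C * ENNReal.ofReal (w x)) :
    w ∈ muckenhouptAlong 𝓘 Ω r := by
  have hr0 : 0 < r - 1 := sub_pos.2 hr
  have avg_le : ∀ I ∈ 𝓘, ∀ c : ℝ≥0∞,
      (∀ x ∈ I, ENNReal.ofReal (w x) ^ (-1 / (r - 1)) ≤ c) → dualAvg r w I ≤ c := by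
    intro I hI' c hc
    obtain ⟨hm, -, hfin, -⟩ := hI I hI'
    rw [dualAvg, setLAverage_eq]
    refine ENNReal.div_le_of_le_mul ?_
    rw [← setLIntegral_const]
    exact setLIntegral_mono measurable_const hc
  have h1' : ∀ x, 1 ≤ ENNReal.ofReal (w x) := fun x ↦ by
    simpa using ENNReal.ofReal_le_ofReal (h1 x)
  have hneg : -1 / (r - 1) < 0 := div_neg_of_neg_of_pos (by norm_num) hr0
  refine ⟨hw, fun I hI' _ ↦ (avg_le I hI' 1 fun x _ ↦ ?_).trans_lt ENNReal.one_lt_top, ?_⟩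
  · exact ENNReal.rpow_le_one_of_one_le_of_neg (h1' x) hneg
  refine lt_of_le_of_lt (iSup₂_le fun I hI' ↦ ?_) hC.lt_top
  obtain ⟨hm, h0, hfin, hA⟩ := hI I hI'.1
  set A := weightAvg w I with hAdef
  have hA1 : 1 ≤ A := by
    rw [hAdef, weightAvg, setLAverage_eq, ENNReal.le_div_iff_mul_le (Or.inl h0) (Or.inl hfin),
      ← setLIntegral_const]
    exact setLIntegral_mono_ae' hm (.of_forall fun x _ ↦ h1' x)
  obtain ⟨x, hx⟩ : I.Nonempty := nonempty_of_measure_ne_zero h0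
  have hAfin : A ≠ ∞ := ne_top_of_le_ne_top (ENNReal.mul_ne_top hC ENNReal.ofReal_ne_top) (hA x hx)
  have hA0 : A ≠ 0 := (zero_lt_one.trans_le hA1).ne'
  -- The `A₁` bound says `w ≥ A / C` on `I`; the negative exponent turns this into an upper bound
  -- for the dual average.
  have hd : dualAvg r w I ≤ (A / C) ^ (-1 / (r - 1)) := by
    refine avg_le I hI'.1 _ fun x hx ↦ ?_
    have h2 : A / C ≤ ENNReal.ofReal (w x) := ENNReal.div_le_of_le_mul' (hA x hx)
    rw [neg_div, ENNReal.rpow_neg, ENNReal.rpow_neg, ENNReal.inv_le_inv]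
    exact ENNReal.rpow_le_rpow h2 (one_div_nonneg.2 hr0.le)
  calc A * dualAvg r w I ^ (r - 1)
      ≤ A * ((A / C) ^ (-1 / (r - 1))) ^ (r - 1) := by gcongr
    _ = A * (A / C)⁻¹ := by
      rw [← ENNReal.rpow_mul, div_mul_cancel₀ _ hr0.ne', ENNReal.rpow_neg_one]
    _ = C := by
      rw [ENNReal.inv_div (Or.inl hC) (Or.inl hC0), ENNReal.mul_div_cancel hA0 hAfin]

lemma le_setLAverage_of_subset {f : ℝ → ℝ≥0∞} {s t : Set ℝ} {c : ℝ≥0∞} {v : ℝ}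
    (ht : MeasurableSet t) (hts : t ⊆ s) (hv : 0 < v) (hvt : volume t = ENNReal.ofReal v)
    (hvs : volume s = ENNReal.ofReal (3 * v)) (hf : ∀ x ∈ t, c ≤ f x) :
    c / 3 ≤ ⨍⁻ x in s, f x ∂volume := by
  have h3 : ENNReal.ofReal (3 * v) = 3 * ENNReal.ofReal v := by
    rw [ENNReal.ofReal_mul (by norm_num)]; simp
  have hv0 : ENNReal.ofReal v ≠ 0 := by simpa using hv
  rw [setLAverage_eq, hvs, h3]
  calc c / 3 = c * ENNReal.ofReal v / (3 * ENNReal.ofReal v) :=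
      (ENNReal.mul_div_mul_right _ _ hv0 ENNReal.ofReal_ne_top).symm
    _ ≤ _ := by
      gcongr
      rw [← hvt, ← setLIntegral_const]
      exact (setLIntegral_mono_ae' ht (.of_forall hf)).trans (lintegral_mono_set hts)

/-! ### The weight in the adic classes and outside `A_r`. -/

namespace IsLacunary

variable {ε y : ℕ → ℝ}

lemma isWeightOn (h : IsLacunary ε y) (Ω : Set ℝ) : IsWeightOn Ω (cuspWeight ε y) :=
  ⟨fun x _ ↦ zero_le_one.trans (h.one_le_cuspWeight x),
    h.locallyIntegrable_cuspWeight.locallyIntegrableOn Ω⟩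

lemma mem_adicMuckenhouptA (h : IsLacunary ε y) {n : ℕ} (hn : 2 ≤ n)
    (hpow : ∀ j, ∃ m : ℤ, y j ≤ (n : ℝ) ^ m ∧ (n : ℝ) ^ m ≤ y j * (1 + ε j ^ 2))
    (Ω : Set ℝ) {r : ℝ} (hr : 1 < r) : cuspWeight ε y ∈ adicMuckenhouptA Ω n r := by
  refine mem_muckenhouptAlong_of_weightAvg_le (C := ENNReal.ofReal 21) hr (h.isWeightOn Ω)
    h.one_le_cuspWeight (by simp) ENNReal.ofReal_ne_top ?_
  rintro I ⟨m, k, rfl⟩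
  have hn0 : (0 : ℝ) < n := by exact_mod_cast (by norm_num : 0 < 2).trans_le hn
  have hm : (0 : ℝ) < (n : ℝ) ^ m := zpow_pos hn0 m
  have hab : ((k : ℝ) - 1) / (n : ℝ) ^ m < (k : ℝ) / (n : ℝ) ^ m := by
    gcongr; linarith
  refine ⟨measurableSet_Ico, ?_, by simp, fun x hx ↦ ?_⟩
  · rw [Real.volume_Ico]
    simpa using hab
  have hx1 := h.one_le_cuspWeight x
  rw [← ENNReal.ofReal_mul (by norm_num)]
  refine weightAvg_Ico_le (by linarith) ?_
  -- The interval lies left of `0`, starts at `0`, or has `k ≥ 2`; in the last case `k ≤ 2 * (k -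
  -- 1)` gives `b ≤ 2 * a`.
  rcases lt_trichotomy k 1 with hk | rfl | hk
  · have hk0 : (k : ℝ) ≤ 0 := by exact_mod_cast Int.lt_add_one_iff.1 hk
    rw [h.lintegral_cuspWeight_of_nonpos (div_nonpos_of_nonpos_of_nonneg hk0 hm.le)]
    exact ENNReal.ofReal_le_ofReal (le_mul_of_one_le_left (sub_nonneg.2 hab.le) (by linarith))
  · have h0 : (((1 : ℤ) : ℝ) - 1) / (n : ℝ) ^ m = 0 := by simp
    rw [h0] at hab ⊢
    refine (h.lintegral_cuspWeight_Ico_zero_le hab.le).trans (ENNReal.ofReal_le_ofReal ?_)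
    rw [sub_zero]
    gcongr
    linarith
  · have hk2 : (2 : ℝ) ≤ k := by exact_mod_cast hk
    refine (h.lintegral_cuspWeight_le hab ?_ (fun j ↦ ?_) hx).trans (ENNReal.ofReal_le_ofReal ?_)
    · rw [← mul_div_assoc]
      gcongr
      linarith
    · obtain ⟨M, h1, h2⟩ := hpow j
      exact ⟨_, h1, h2, zpow_le_or_le_zpow hn m M k hk⟩
    · have := sub_nonneg.2 hab.le
      nlinarith [mul_nonneg this (zero_le_one.trans hx1)]

lemma notMem_muckenhouptA (h : IsLacunary ε y) (hε : ∀ δ > 0, ∃ j, ε j < δ) {Ω : Set ℝ}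
    (hΩ : ∀ j, Ico (y j / 2) (2 * y j) ⊆ Ω) {r : ℝ} (hr : 1 < r) :
    cuspWeight ε y ∉ muckenhouptA Ω r := by
  rintro ⟨-, -, hsup⟩
  have hr0 : 0 < r - 1 := sub_pos.2 hr
  set K := ⨆ I ∈ {I ∈ boundedIntervals | I ⊆ Ω},
    weightAvg (cuspWeight ε y) I * dualAvg r (cuspWeight ε y) I ^ (r - 1) with hK
  have key : ∀ j, ENNReal.ofReal (1 / √(ε j)) / 3 * (1 / 3) ^ (r - 1) ≤ K := by
    intro j
    have h1 := h.eps_pos j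
    have h2 := h.eps_le j
    have h3 := h.pos j
    have hεy : 0 < ε j * y j := by positivity
    have hεy4 : ε j * y j ≤ y j / 4 := by nlinarith
    -- The test interval consists of three pieces of length `ε j * y j`: the weight is `1` on the
    -- first and `1 / √(ε j)` on the last, so each average retains a third of the corresponding
    -- value.
    set a := y j - 2 * (ε j * y j) with ha
    have hloc : ∀ x ∈ Ico a (y j + ε j * y j), cuspWeight ε y x = bump (ε j) (y j) x :=
      fun x hx ↦ cuspWeight_eq_bump fun i hi ↦
        h.bump_eq_one_of_ne hi (by linarith [hx.1]) (by linarith [hx.2])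
    have hvol : volume (Ico a (y j + ε j * y j)) = ENNReal.ofReal (3 * (ε j * y j)) := by
      rw [Real.volume_Ico]; congr 1; ring
    have hmem : Ico a (y j + ε j * y j) ∈ {I ∈ boundedIntervals | I ⊆ Ω} :=
      ⟨⟨_, _, by linarith, rfl⟩,
        (Ico_subset_Ico (by linarith) (by linarith)).trans (hΩ j)⟩
    refine le_trans ?_ (le_iSup₂_of_le _ hmem le_rfl)
    gcongr
    · refine le_setLAverage_of_subset (t := Ico (y j) (y j + ε j * y j)) measurableSet_Ico
        (Ico_subset_Ico_left (by linarith)) hεy (by simp) hvol fun x hx ↦ ?_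
      rw [hloc x ⟨by linarith [hx.1], hx.2⟩, bump_eq_right h1 (h.eps_le_one j) h3 hx.1,
        cusp_of_le]
      rw [div_le_iff₀ h3]
      linarith [hx.2]
    · refine le_setLAverage_of_subset (t := Ico a (y j - ε j * y j)) measurableSet_Ico
        (Ico_subset_Ico_right (by linarith)) hεy ?_ hvol fun x hx ↦ ?_
      · rw [Real.volume_Ico]; congr 1; ring
      rw [hloc x ⟨hx.1, by linarith [hx.2]⟩, bump_eq_one_of_le h1 h2 h3 (by linarith [hx.2])]
      simp
  have hc0 : ((1 / 3 : ℝ≥0∞) ^ (r - 1)) ≠ 0 := by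
    simp [ENNReal.rpow_eq_zero_iff]
  have hfin : K / (1 / 3) ^ (r - 1) * 3 ≠ ∞ :=
    ENNReal.mul_ne_top (ENNReal.div_ne_top hsup.ne hc0) (by simp)
  set R := (K / (1 / 3) ^ (r - 1) * 3).toReal with hR
  have hR0 : 0 ≤ R := ENNReal.toReal_nonneg
  have hle : ∀ j, 1 / √(ε j) ≤ R := by
    intro j
    rw [← ENNReal.ofReal_le_iff_le_toReal hfin]
    rw [← ENNReal.div_le_iff (by simp) (by simp)]
    exact ENNReal.le_div_iff_mul_le (Or.inl hc0)
      (Or.inl (ENNReal.rpow_ne_top_of_nonneg hr0.le (by simp))) |>.2 (key j)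
  obtain ⟨j, hj⟩ := hε (1 / (R + 1) ^ 2) (by positivity)
  have h4 : 0 < √(ε j) := Real.sqrt_pos.2 (h.eps_pos j)
  have h5 : √(ε j) < 1 / (R + 1) := by
    rw [Real.sqrt_lt' (by positivity), div_pow, one_pow]
    exact hj
  have h6 := hle j
  rw [div_le_iff₀ h4] at h6
  rw [lt_div_iff₀ (by positivity)] at h5
  nlinarith

end IsLacunary

/-! ### Conclusion. -/

/-- For finitely many bases `n ≥ 2` there is a weight that satisfies every `n`-adic Muckenhoupt
condition, but no Muckenhoupt condition on any domain that contains `[0, 1)`. -/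
lemma exists_adic_not_muckenhoupt (S : Finset ℕ) (hS : ∀ n ∈ S, 2 ≤ n) :
    ∃ w : ℝ → ℝ, (∀ Ω : Set ℝ, ∀ n ∈ S, ∀ r : ℝ, 1 < r → w ∈ adicMuckenhouptA Ω n r) ∧
      ∀ Ω : Set ℝ, Ico 0 1 ⊆ Ω → ∀ r : ℝ, 1 < r → w ∉ muckenhouptA Ω r := by
  obtain ⟨y, hy, hle, hpow⟩ := exists_isLacunary S hS
  refine ⟨cuspWeight (fun j : ℕ ↦ 1 / ((j : ℝ) + 4)) y,
    fun Ω n hn r hr ↦ hy.mem_adicMuckenhouptA (hS n hn) (hpow n hn) Ω hr,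
    fun Ω hΩ r hr ↦ hy.notMem_muckenhouptA (fun δ hδ ↦ ?_) (fun j ↦ ?_) hr⟩
  · obtain ⟨j, hj⟩ := exists_nat_one_div_lt hδ
    exact ⟨j, (one_div_le_one_div_of_le (by positivity) (by linarith)).trans_lt hj⟩
  · exact (Ico_subset_Ico (by linarith [hy.pos j]) (by linarith [hle j])).trans hΩ

theorem mainTheorem4 (S : Finset ℕ) (hS : ∀ p ∈ S, p.Prime) :
    -- weights on the real line
    ((∀ r : ℝ, 1 < r → (⋂ p ∈ S, adicMuckenhouptA univ p r) ≠ muckenhouptA univ r) ∧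
      (⋂ p ∈ S, adicMuckenhouptAInfty univ p) ≠ muckenhouptAInfty univ) ∧
    -- weights on the unit interval
    ((∀ r : ℝ, 1 < r →
        (⋂ p ∈ S, adicMuckenhouptA (Ico 0 1) p r) ≠ muckenhouptA (Ico 0 1) r) ∧
      (⋂ p ∈ S, adicMuckenhouptAInfty (Ico 0 1) p) ≠ muckenhouptAInfty (Ico 0 1)) := by
  obtain ⟨w, hadic, hnot⟩ := exists_adic_not_muckenhoupt S fun p hp ↦ (hS p hp).two_le
  have hA : ∀ Ω : Set ℝ, Ico 0 1 ⊆ Ω → ∀ r : ℝ, 1 < r →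
      (⋂ p ∈ S, adicMuckenhouptA Ω p r) ≠ muckenhouptA Ω r := fun Ω hΩ r hr heq ↦
    hnot Ω hΩ r hr (heq ▸ mem_iInter₂.2 fun p hp ↦ hadic Ω p hp r hr)
  have hAInfty : ∀ Ω : Set ℝ, Ico 0 1 ⊆ Ω →
      (⋂ p ∈ S, adicMuckenhouptAInfty Ω p) ≠ muckenhouptAInfty Ω := by
    intro Ω hΩ heq
    have hw : w ∈ muckenhouptAInfty Ω := heq ▸ mem_iInter₂.2 fun p hp ↦
      mem_iUnion₂.2 ⟨2, mem_Ioi.2 one_lt_two, hadic Ω p hp 2 one_lt_two⟩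
    obtain ⟨r, hr, hwr⟩ := mem_iUnion₂.1 hw
    exact hnot Ω hΩ r hr hwr
  exact ⟨⟨hA _ (subset_univ _), hAInfty _ (subset_univ _)⟩, hA _ subset_rfl, hAInfty _ subset_rfl⟩
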